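/- Assume the Generalized Continuum Hypothesis ($2^{\kappa}=\kappa^{+}$ for every infinite cardinal $\kappa$). Let $F\colon \mathbf{Set}\to\mathbf{Set}$ be a functor which either preserves limits of $\omega^{\mathrm{op}}$-chains $\cdots\to X_2\to X_1\to X_0$, or is finitary (that is, preserves filtered colimits). If $F$ has an initial algebra $\mu F$ whose underlying set has cardinality $\lambda$, where $\lambda$ is an uncountable regular cardinal, then $F$ has a terminal coalgebra $\nu F$, and the underlying set of $\nu F$ also has cardinality $\lambda$. -/

import Mathlib

open CategoryTheory CategoryTheory.Limits CategoryTheory.Endofunctor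
open scoped Cardinal

universe u

/-- The Generalized Continuum Hypothesis (for sets in `Type u`): `2 ^ κ` is the successor of `κ`,
for every infinite cardinal `κ`. -/
def GCH : Prop := ∀ κ : Cardinal.{u}, ℵ₀ ≤ κ → (2 : Cardinal.{u}) ^ κ = Order.succ κ

/-- A set functor is finitary if it preserves filtered colimits. -/
def IsFinitary (F : Type u ⥤ Type u) : Prop := PreservesFilteredColimits F

/-- A set functor preserves `ω^op`-limits, i.e. limits of `ω^op`-chains `⋯ ⟶ X₂ ⟶ X₁ ⟶ X₀`. -/
def PreservesOmegaOpLimits (F : Type u ⥤ Type u) : Prop := PreservesLimitsOfShape ℕᵒᵖ F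

universe v

/-! Let `λ = #μF`. Lower bound: by Lambek's lemma `νF` is also an algebra with bijective structure,
and the algebra morphism `μF ⟶ νF` is injective (`initialAlgebra_hom_injective`). Upper bound: GCH
and regularity give `λ ^ ℵ₀ = λ`, and Lambek's lemma `F(μF) ≅ μF` makes `F` send nonempty sets of
size at most `λ` to such sets. If `F` preserves `ω^op`-limits, `νF` is the limit of the terminal
chain, inside a countable product of such sets. If `F` is finitary, `νF` is a quotient of the
disjoint union of all coalgebras on subsets of `ℕ`. -/

theorem GCH.power_aleph0_le (gch : GCH.{u}) {c : Cardinal.{u}} (hc : c.IsRegular) (h : ℵ₀ < c) :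
    c ^ ℵ₀ ≤ c := by
  -- The only use of GCH. Taking `max d ℵ₀`, still below `c`, covers finite `d`.
  have key : ∀ d < c, d ^ (ℵ₀ : Cardinal.{u}) ≤ c := fun d hd ↦ by
    have hm : ℵ₀ ≤ max d ℵ₀ := le_max_right _ _
    calc d ^ (ℵ₀ : Cardinal.{u}) ≤ (max d ℵ₀) ^ (max d ℵ₀) :=
          (Cardinal.power_le_power_right (le_max_left _ _)).trans
            (Cardinal.power_le_power_left (Cardinal.aleph0_pos.trans_le hm).ne' hm)
      _ = Order.succ (max d ℵ₀) := by rw [Cardinal.power_self_eq hm, gch _ hm]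
      _ ≤ c := Order.succ_le_of_lt (max_lt hd h)
  let α := c.ord.ToType
  have hα : #α = c := Cardinal.mk_ord_toType c
  have h' : ℵ₀ < Order.cof α := by rwa [Ordinal.cof_toType, hc.cof_ord]
  let B : α → Set (ULift.{u} ℕ → α) := fun a ↦ {f | ∀ n, f n < a}
  have hB : ∀ a, #(B a) ≤ c := fun a ↦ by
    refine le_trans ?_ (key #(Set.Iio a) ((Cardinal.mk_Iio_lt a (by simp [α])).trans_eq hα))
    have : #(B a) ≤ #(ULift.{u} ℕ → Set.Iio a) :=
      Cardinal.mk_le_of_injective (f := fun f n ↦ ⟨f.1 n, f.2 n⟩) fun f g e ↦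
        Subtype.ext (funext fun n ↦ congrArg Subtype.val (congrFun e n))
    simpa using this
  -- An unbounded sequence would have countable cofinal range, against cofinality `c > ℵ₀`.
  have hU : ⋃ a, B a = Set.univ := by
    refine Set.eq_univ_of_forall fun f ↦ Set.mem_iUnion.2 ?_
    by_contra! hf
    have hcof : IsCofinal (Set.range f) := fun a ↦ by
      obtain ⟨n, hn⟩ := not_forall.1 (hf a)
      exact ⟨f n, ⟨n, rfl⟩, not_lt.1 hn⟩
    refine absurd ((Order.cof_le hcof).trans (Cardinal.mk_range_le.trans_eq ?_)) (not_le.2 h')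
    simp
  calc c ^ (ℵ₀ : Cardinal.{u}) = #(ULift.{u} ℕ → α) := by simp [hα]
    _ = #(⋃ a, B a) := by rw [hU, Cardinal.mk_univ]
    _ ≤ Cardinal.sum fun a ↦ #(B a) := Cardinal.mk_iUnion_le_sum_mk
    _ ≤ Cardinal.sum fun _ : α ↦ c := Cardinal.sum_le_sum _ _ hB
    _ = c := by rw [Cardinal.sum_const', hα, Cardinal.mul_eq_self hc.aleph0_le]

/-! ### The terminal coalgebra as limit of the terminal chain -/

section TerminalChain

variable {C : Type u} [Category.{v} C] [HasTerminal C] (F : C ⥤ C)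

/-- The objects `Fⁿ 1` of the terminal chain of an endofunctor. -/
noncomputable def terminalChainObj : ℕ → C
  | 0 => ⊤_ C
  | n + 1 => F.obj (terminalChainObj n)

/-- The connecting morphisms `Fⁿ⁺¹ 1 ⟶ Fⁿ 1` of the terminal chain. -/
noncomputable def terminalChainMap : ∀ n, terminalChainObj F (n + 1) ⟶ terminalChainObj F n
  | 0 => terminal.from _
  | n + 1 => F.map (terminalChainMap n)

/-- The terminal chain `⋯ ⟶ F (F 1) ⟶ F 1 ⟶ 1` of an endofunctor. -/
noncomputable abbrev terminalChain : ℕᵒᵖ ⥤ C := Functor.ofOpSequence (terminalChainMap F)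

variable {F}

/-- The projections of a cone over the terminal chain. -/
noncomputable def Cone.terminalChainProj (s : Cone (terminalChain F)) (n : ℕ) :
    s.pt ⟶ terminalChainObj F n :=
  s.π.app ⟨n⟩

lemma Cone.terminalChainProj_w (s : Cone (terminalChain F)) (n : ℕ) :
    Cone.terminalChainProj s (n + 1) ≫ terminalChainMap F n = Cone.terminalChainProj s n := by
  have := s.w (homOfLE (Nat.le_add_right n 1)).op
  rwa [Functor.ofOpSequence_map_homOfLE_succ] at this

/-- A cone over the terminal chain, from a compatible family of morphisms. -/
noncomputable def terminalChainCone {X : C} (π : ∀ n, X ⟶ terminalChainObj F n)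
    (w : ∀ n, π (n + 1) ≫ terminalChainMap F n = π n) : Cone (terminalChain F) where
  pt := X
  π := NatTrans.ofOpSequence (fun n ↦ π n) fun n ↦ by
    rw [Functor.ofOpSequence_map_homOfLE_succ]
    exact (Category.id_comp _).trans (w n).symm

/-- The shifted cone over the image of the terminal chain. -/
noncomputable def shiftedTerminalChainCone (s : Cone (terminalChain F)) :
    Cone (terminalChain F ⋙ F) where
  pt := s.pt
  π := NatTrans.ofOpSequence (fun n ↦ Cone.terminalChainProj s (n + 1)) fun n ↦ by
    rw [Functor.comp_map, Functor.ofOpSequence_map_homOfLE_succ]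
    exact (Category.id_comp _).trans (Cone.terminalChainProj_w s (n + 1)).symm

/-- The limit of the terminal chain as a coalgebra, if the functor preserves that limit. -/
noncomputable def terminalChainCoalgebra (s : Cone (terminalChain F))
    (h : IsLimit (F.mapCone s)) : Coalgebra F where
  V := s.pt
  str := h.lift (shiftedTerminalChainCone s)

/-- The projections of the limit of the terminal chain. -/
noncomputable def terminalChainCoalgebraProj (s : Cone (terminalChain F))
    (h : IsLimit (F.mapCone s)) (n : ℕ) :
    (terminalChainCoalgebra s h).V ⟶ terminalChainObj F n :=
  Cone.terminalChainProj s n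

lemma terminalChainCoalgebra_str_map (s : Cone (terminalChain F))
    (h : IsLimit (F.mapCone s)) (n : ℕ) :
    (terminalChainCoalgebra s h).str ≫ F.map (terminalChainCoalgebraProj s h n) =
      terminalChainCoalgebraProj s h (n + 1) :=
  h.fac (shiftedTerminalChainCone s) ⟨n⟩

/-- The canonical morphisms from a coalgebra to the members of the terminal chain. -/
noncomputable def Coalgebra.toTerminalChain (V : Coalgebra F) : ∀ n, V.V ⟶ terminalChainObj F n
  | 0 => terminal.from _
  | n + 1 => V.str ≫ F.map (toTerminalChain V n)

lemma Coalgebra.toTerminalChain_w (V : Coalgebra F) (n : ℕ) :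
    toTerminalChain V (n + 1) ≫ terminalChainMap F n = toTerminalChain V n := by
  induction n with
  | zero => exact Subsingleton.elim (α := _ ⟶ ⊤_ C) _ _
  | succ n ih =>
    change (V.str ≫ F.map _) ≫ F.map _ = V.str ≫ F.map _
    rw [Category.assoc, ← F.map_comp, ih]

/-- The limit of the terminal chain is a terminal coalgebra, if the functor preserves that limit. -/
noncomputable def terminalChainCoalgebraIsTerminal {s : Cone (terminalChain F)} (hs : IsLimit s)
    (h : IsLimit (F.mapCone s)) : IsTerminal (terminalChainCoalgebra s h) := by
  have str_map := terminalChainCoalgebra_str_map s h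
  let f (V : Coalgebra F) : V.V ⟶ (terminalChainCoalgebra s h).V :=
    hs.lift (terminalChainCone (Coalgebra.toTerminalChain V) (Coalgebra.toTerminalChain_w V))
  have fac (V : Coalgebra F) (n : ℕ) :
      f V ≫ terminalChainCoalgebraProj s h n = Coalgebra.toTerminalChain V n :=
    hs.fac _ ⟨n⟩
  have hf (V : Coalgebra F) :
      V.str ≫ F.map (f V) = f V ≫ (terminalChainCoalgebra s h).str := by
    refine h.hom_ext fun ⟨n⟩ ↦ ?_
    change (V.str ≫ F.map (f V)) ≫ F.map (terminalChainCoalgebraProj s h n) =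
      (f V ≫ (terminalChainCoalgebra s h).str) ≫ F.map (terminalChainCoalgebraProj s h n)
    rw [Category.assoc, Category.assoc, str_map, ← F.map_comp, fac]
    exact (fac V (n + 1)).symm
  refine IsTerminal.ofUniqueHom (fun V ↦ ⟨f V, hf V⟩) fun V m ↦ Coalgebra.Hom.ext ?_
  have key : ∀ n, m.f ≫ terminalChainCoalgebraProj s h n = Coalgebra.toTerminalChain V n := by
    intro n
    induction n with
    | zero => exact Subsingleton.elim (α := _ ⟶ ⊤_ C) _ _
    | succ n ih =>
      have := congrArg (· ≫ F.map (terminalChainCoalgebraProj s h n)) m.h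
      simp only [Category.assoc, str_map, ← F.map_comp, ih] at this
      exact this.symm
  exact hs.hom_ext fun ⟨n⟩ ↦ (key n).trans (fac V n).symm

end TerminalChain

/-! ### Algebras and coalgebras in the category of types -/

lemma Functor.map_injective_of_nonempty (F : Type u ⥤ Type v) {X Y : Type u} [Nonempty X]
    (f : X ⟶ Y) (hf : Function.Injective f) : Function.Injective (F.map f) := by
  have : f ≫ ↾(Function.invFun f) = 𝟙 X := by
    ext x
    exact Function.leftInverse_invFun hf x
  refine Function.LeftInverse.injective (g := F.map (↾(Function.invFun f))) fun x ↦ ?_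
  rw [← F.map_comp_apply, this, F.map_id_apply]

/-- An algebra morphism from a nonempty initial algebra to an algebra with injective structure
is injective. -/
theorem initialAlgebra_hom_injective {F : Type u ⥤ Type u} {A T : Algebra F} (hA : IsInitial A)
    [Nonempty A.a] (hT : Function.Injective T.str) (h : A ⟶ T) : Function.Injective h.f := by
  let incl (U : Set A.a) : (U : Type u) ⟶ A.a := ↾Subtype.val
  let Φ (U : Set A.a) : Set A.a := Set.range (F.map (incl U) ≫ A.str)
  have hΦ : Monotone Φ := by
    rintro U V hUV _ ⟨w, rfl⟩
    refine ⟨F.map (↾(Set.inclusion hUV)) w, ?_⟩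
    have : incl U = ↾(Set.inclusion hUV) ≫ incl V := rfl
    rw [this, F.map_comp]
    rfl
  have inj : ∀ U : Set A.a, Set.InjOn h.f U → Set.InjOn h.f (Φ U) := by
    rintro U hU _ ⟨w, rfl⟩ _ ⟨w', rfl⟩ e
    have hh : ∀ x, h.f (A.str x) = T.str (F.map h.f x) := fun x ↦
      (types_congr_hom h.h x).symm
    have e' : F.map h.f (F.map (incl U) w) = F.map h.f (F.map (incl U) w') :=
      hT ((hh _).symm.trans (e.trans (hh _)))
    -- A retraction defined on all of `T.a`, with values in `A.a` rather than `U`, also serves for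
    -- empty `U`, where `F` need not preserve injectivity.
    have hg : ∃ g : T.a ⟶ A.a, incl U ≫ h.f ≫ g = incl U := by
      refine ⟨↾(Function.invFunOn h.f U), ?_⟩
      ext x
      exact hU.leftInvOn_invFunOn x.2
    obtain ⟨g, hg⟩ := hg
    have e2 := congr_arg (F.map g) e'
    simp only [← F.map_comp_apply, hg, Category.assoc] at e2
    exact congr_arg A.str e2
  obtain ⟨U, hU⟩ : ∃ U, Maximal (fun U ↦ U ⊆ Φ U ∧ Set.InjOn h.f U) U := by
    refine zorn_subset _ fun c hc hchain ↦ ⟨⋃₀ c, ⟨?_, ?_⟩, fun s ↦ Set.subset_sUnion_of_mem⟩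
    · exact Set.sUnion_subset fun s hs ↦ (hc hs).1.trans (hΦ (Set.subset_sUnion_of_mem hs))
    · rintro x ⟨s, hs, hx⟩ y ⟨t, ht, hy⟩
      obtain h | h := hchain.total hs ht
      · exact (hc ht).2 (h hx) hy
      · exact (hc hs).2 hx (h hy)
  -- `Φ U` has both properties too, so maximality makes `U` a subalgebra, and a subalgebra of an
  -- initial algebra is everything.
  have hfix : Φ U ⊆ U := hU.2 ⟨hΦ hU.1.1, inj U hU.1.2⟩ hU.1.1
  let S : Algebra F :=
    { a := U
      str := ↾fun w ↦ ⟨A.str (F.map (incl U) w), hfix ⟨w, rfl⟩⟩ }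
  let i : S ⟶ A := { f := incl U, h := rfl }
  have hid : hA.to S ≫ i = 𝟙 A := hA.hom_ext _ _
  have huniv : ∀ x, x ∈ U := fun x ↦ by
    have : i.f ((hA.to S).f x) = x := types_congr_hom (congrArg Algebra.Hom.f hid) x
    exact this ▸ ((hA.to S).f x).2
  exact fun x y e ↦ hU.1.2 (huniv x) (huniv y) e

/-! ### Colimits of families of coalgebras -/

section CoalgebraFamily

variable {F : Type u ⥤ Type u} {I : Type u} (K : I → Coalgebra F)

/-- Elements of members of a family of coalgebras are related if a coalgebra morphism between
these members maps the first to the second. -/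
def coalgebraFamilyRel (x y : Σ i, (K i).V) : Prop :=
  ∃ f : K x.1 ⟶ K y.1, f.f x.2 = y.2

/-- The canonical map of a member of a family of coalgebras to the colimit of the family. -/
def coalgebraFamilyι (i : I) : (K i).V ⟶ Quot (coalgebraFamilyRel K) :=
  ↾fun x ↦ Quot.mk _ ⟨i, x⟩

variable {K} in
lemma map_coalgebraFamilyι {i j : I} (f : K i ⟶ K j) :
    f.f ≫ coalgebraFamilyι K j = coalgebraFamilyι K i := by
  ext x
  exact (Quot.sound ⟨f, rfl⟩).symm

/-- The colimit of the full subcategory of coalgebras on the members of a family. -/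
def coalgebraFamilyColimit : Coalgebra F where
  V := Quot (coalgebraFamilyRel K)
  str := ↾(Quot.lift (fun x ↦ F.map (coalgebraFamilyι K x.1) ((K x.1).str x.2)) (by
    rintro ⟨i, x⟩ ⟨j, y⟩ ⟨f : K i ⟶ K j, hf : f.f x = y⟩
    have h : (K j).str (f.f x) = F.map f.f ((K i).str x) := (types_congr_hom f.h x).symm
    dsimp only
    rw [← hf, h, ← F.map_comp_apply, map_coalgebraFamilyι]))

/-- The canonical coalgebra morphism of a member of a family to the colimit of the family. -/
def coalgebraFamilyHom (i : I) : K i ⟶ coalgebraFamilyColimit K where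
  f := coalgebraFamilyι K i
  h := rfl

variable {K} in
lemma comp_coalgebraFamilyHom {i j : I} (f : K i ⟶ K j) :
    f ≫ coalgebraFamilyHom K j = coalgebraFamilyHom K i :=
  Coalgebra.Hom.ext (map_coalgebraFamilyι f)

variable {K} in
/-- If a family of coalgebras covers every coalgebra, and any two morphisms from its members to a
coalgebra factorize through a subcoalgebra in the family, then its colimit is terminal. -/
theorem coalgebraFamilyColimit_isTerminal
    (cover : ∀ (V : Coalgebra F) (v : V.V), ∃ (i : I) (f : K i ⟶ V), v ∈ Set.range f.f)
    (amalg : ∀ (V : Coalgebra F) (i j : I) (f : K i ⟶ V) (g : K j ⟶ V),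
      ∃ (k : I) (m : K k ⟶ V) (f' : K i ⟶ K k) (g' : K j ⟶ K k),
        Function.Injective m.f ∧ f' ≫ m = f ∧ g' ≫ m = g) :
    Nonempty (IsTerminal (coalgebraFamilyColimit K)) := by
  -- Elements identified in some coalgebra are already equal in the colimit. This gives both the
  -- well-definedness of `β` and uniqueness.
  have key : ∀ (V : Coalgebra F) (i j : I) (f : K i ⟶ V) (g : K j ⟶ V) (x : (K i).V)
      (y : (K j).V), f.f x = g.f y → (coalgebraFamilyHom K i).f x = (coalgebraFamilyHom K j).f y := by
    intro V i j f g x y e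
    obtain ⟨k, m, f', g', hm, rfl, rfl⟩ := amalg V i j f g
    have e' : f'.f x = g'.f y := hm e
    rw [← comp_coalgebraFamilyHom f', ← comp_coalgebraFamilyHom g']
    exact congr_arg (coalgebraFamilyHom K k).f e'
  choose i f x hx using cover
  let β (V : Coalgebra F) : V.V ⟶ (coalgebraFamilyColimit K).V :=
    ↾fun v ↦ (coalgebraFamilyHom K (i V v)).f (x V v)
  have hβ : ∀ (V : Coalgebra F) (j : I) (g : K j ⟶ V), g.f ≫ β V = (coalgebraFamilyHom K j).f := by
    intro V j g
    ext y
    exact key V _ _ _ g _ y (hx V (g.f y))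
  refine ⟨IsTerminal.ofUniqueHom (fun V ↦ ⟨β V, ?_⟩) fun V m ↦ Coalgebra.Hom.ext ?_⟩
  · ext v
    change F.map (β V) (V.str v) =
      (coalgebraFamilyColimit K).str ((coalgebraFamilyHom K (i V v)).f (x V v))
    have h1 : V.str v = F.map (f V v).f ((K _).str (x V v)) := by
      conv_lhs => rw [← hx V v]
      exact (types_congr_hom (f V v).h (x V v)).symm
    rw [h1, ← F.map_comp_apply, hβ]
    exact types_congr_hom (coalgebraFamilyHom K (i V v)).h (x V v)
  · ext v
    change m.f v = (coalgebraFamilyHom K (i V v)).f (x V v)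
    obtain ⟨⟨j, y⟩, hy : (coalgebraFamilyHom K j).f y = m.f v⟩ := Quot.exists_rep (m.f v)
    rw [← hy]
    refine (key _ _ _ (f V v ≫ m) (coalgebraFamilyHom K j) (x V v) y ?_).symm
    rw [hy]
    exact congr_arg m.f (hx V v)

end CoalgebraFamily

/-! ### Countable coalgebras of finitary functors -/

/-- Elements of values of a finitary set functor are supported by finite subsets. -/
lemma IsFinitary.exists_finset {F : Type u ⥤ Type u} (hF : IsFinitary F) {X : Type u}
    (x : F.obj X) :
    ∃ S : Finset X, x ∈ Set.range (F.map (↾(Subtype.val : {x // x ∈ S} → X))) := by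
  classical
  have : PreservesFilteredColimits F := hF
  let D : Finset X ⥤ Type u :=
    { obj := fun S ↦ {x // x ∈ S}
      map := fun f ↦ ↾fun x ↦ ⟨x.1, leOfHom f x.2⟩ }
  let t : Cocone D :=
    { pt := X
      ι := { app := fun S ↦ ↾Subtype.val } }
  have ht : IsColimit t := Types.FilteredColimit.isColimitOf' D t
    (fun x ↦ ⟨{x}, ⟨x, Finset.mem_singleton_self x⟩, rfl⟩)
    (fun S x y h ↦ ⟨S, 𝟙 S, congr_arg (D.map (𝟙 S)) (Subtype.ext h)⟩)
  obtain ⟨S, y, hy⟩ := Types.jointly_surjective_of_isColimit (isColimitOfPreserves F ht) x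
  exact ⟨S, y, hy⟩

lemma exists_countable_closed {X : Type u} (supp : X → Finset X) {B : Set X} (hB : B.Countable) :
    ∃ C : Set X, C.Countable ∧ B ⊆ C ∧ ∀ x ∈ C, ↑(supp x) ⊆ C := by
  let Ψ (S : Set X) : Set X := S ∪ ⋃ x ∈ S, ↑(supp x)
  refine ⟨⋃ n, Ψ^[n] B, Set.countable_iUnion fun n ↦ ?_,
    Set.subset_iUnion (fun n ↦ Ψ^[n] B) 0, fun x hx ↦ ?_⟩
  · induction n with
    | zero => exact hB
    | succ n ih =>
      rw [Function.iterate_succ_apply']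
      exact ih.union (ih.biUnion fun x _ ↦ (supp x).countable_toSet)
  · obtain ⟨n, hn⟩ := Set.mem_iUnion.1 hx
    refine Set.Subset.trans ?_ (Set.subset_iUnion (fun n ↦ Ψ^[n] B) (n + 1))
    rw [Function.iterate_succ_apply']
    exact (Set.subset_biUnion_of_mem (u := fun x ↦ (↑(supp x) : Set X)) hn).trans
      Set.subset_union_right

/-- The coalgebras carried by sets of natural numbers. -/
def countableCoalgebra (F : Type u ⥤ Type u)
    (i : Σ S : Set (ULift.{u} ℕ), (S → F.obj S)) : Coalgebra F where
  V := i.1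
  str := ↾i.2

/-- Every countable subset of a coalgebra of a finitary set functor is contained in a countable
subcoalgebra. -/
lemma IsFinitary.exists_countableCoalgebra {F : Type u ⥤ Type u} (hF : IsFinitary F)
    (V : Coalgebra F) {B : Set V.V} (hB : B.Countable) :
    ∃ i, ∃ m : countableCoalgebra F i ⟶ V, Function.Injective m.f ∧ B ⊆ Set.range m.f := by
  choose supp y hy using fun v ↦ hF.exists_finset (V.str v)
  obtain ⟨C, hC, hBC, hclosed⟩ := exists_countable_closed supp hB
  have := hC.to_subtype
  obtain ⟨e, he⟩ := exists_injective_nat C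
  -- Moving `C` into `ℕ` keeps the family of coalgebras indexed by a set.
  let S : Set (ULift.{u} ℕ) := Set.range fun c ↦ ULift.up (e c)
  let ε : C ≃ S := Equiv.ofInjective _ (ULift.up_injective.comp he)
  let m : (S : Type u) ⟶ V.V := ↾fun s ↦ (ε.symm s).1
  -- `V.str (m s)` comes from its finite support, which lies in the closed set `C`.
  have hstr : ∀ s, ∃ w, F.map m w = V.str (m s) := fun s ↦ by
    let j : ({x // x ∈ supp (m s)} : Type u) ⟶ S :=
      ↾fun x ↦ ε ⟨x.1, hclosed _ (ε.symm s).2 x.2⟩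
    refine ⟨F.map j (y (m s)), ?_⟩
    have hj : j ≫ m = ↾Subtype.val := by
      ext x
      exact congrArg Subtype.val (ε.symm_apply_apply _)
    rw [← F.map_comp_apply, hj, hy]
  choose γ hγ using hstr
  refine ⟨⟨S, γ⟩, ⟨m, ?_⟩, ?_, fun b hb ↦ ⟨ε ⟨b, hBC hb⟩, ?_⟩⟩
  · ext s
    exact hγ s
  · exact Subtype.val_injective.comp ε.symm.injective
  · exact congrArg Subtype.val (ε.symm_apply_apply _)

/-- Coalgebra morphisms factorize through injective ones which contain their range. -/
lemma Coalgebra.exists_lift_of_range_subset {F : Type u ⥤ Type u} {U V W : Coalgebra F} (m : U ⟶ V)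
    (hm : Function.Injective m.f) (f : W ⟶ V) (h : Set.range f.f ⊆ Set.range m.f) :
    ∃ f' : W ⟶ U, f' ≫ m = f := by
  choose g hg using fun w ↦ h ⟨w, rfl⟩
  have hgm : (↾g) ≫ m.f = f.f := by
    ext w
    exact hg w
  refine ⟨⟨↾g, ?_⟩, Coalgebra.Hom.ext hgm⟩
  ext w
  have : Nonempty U.V := ⟨g w⟩
  apply Functor.map_injective_of_nonempty F m.f hm
  change F.map m.f (F.map (↾g) (W.str w)) = F.map m.f (U.str (g w))
  rw [← F.map_comp_apply, hgm]
  refine (types_congr_hom f.h w).trans ?_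
  refine Eq.trans ?_ (types_congr_hom m.h (g w)).symm
  exact congr_arg V.str (hg w).symm

/-- The colimit of all countable coalgebras is terminal for a finitary set functor. -/
theorem IsFinitary.countableCoalgebraColimit_isTerminal {F : Type u ⥤ Type u} (hF : IsFinitary F) :
    Nonempty (IsTerminal (coalgebraFamilyColimit (countableCoalgebra F))) := by
  refine coalgebraFamilyColimit_isTerminal (fun V v ↦ ?_) fun V i j f g ↦ ?_
  · obtain ⟨i, m, -, h⟩ := hF.exists_countableCoalgebra V (Set.countable_singleton v)
    exact ⟨i, m, h rfl⟩
  · have hc (i) {X : Type u} (f : (countableCoalgebra F i).V ⟶ X) : (Set.range f).Countable :=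
      Set.countable_range (ι := i.1) f
    obtain ⟨k, m, hm, h⟩ := hF.exists_countableCoalgebra V
      ((hc i f.f).union (hc j g.f))
    obtain ⟨f', hf'⟩ := Coalgebra.exists_lift_of_range_subset m hm f (Set.subset_union_left.trans h)
    obtain ⟨g', hg'⟩ := Coalgebra.exists_lift_of_range_subset m hm g (Set.subset_union_right.trans h)
    exact ⟨k, m, f', g', hm, hf', hg'⟩

/-! ### Cardinalities -/

lemma mk_obj_le_of_mk_le (F : Type u ⥤ Type u) {X A : Type u} [Nonempty X] (h : #X ≤ #A) :
    #(F.obj X) ≤ #(F.obj A) := by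
  obtain ⟨f⟩ := h
  exact Cardinal.mk_le_of_injective (Functor.map_injective_of_nonempty F (↾f) f.injective)

/-- There are `2 ^ ℵ₀` carriers, at most `#A ^ ℵ₀` structures on each, and countably many elements
in each coalgebra. -/
lemma mk_countableCoalgebraColimit_le (F : Type u ⥤ Type u) {A : Type u}
    (hA : #(F.obj A) ≤ #A) (hpow : #A ^ ℵ₀ ≤ #A) (h : ℵ₀ ≤ #A) :
    #(coalgebraFamilyColimit (countableCoalgebra F)).V ≤ #A := by
  have h0 : #A ≠ 0 := (Cardinal.aleph0_pos.trans_le h).ne'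
  have hS (S : Set (ULift.{u} ℕ)) : #(S → F.obj S) ≤ #A := by
    obtain hS | hS := isEmpty_or_nonempty S
    · rw [← Cardinal.power_def, Cardinal.mk_eq_zero S, Cardinal.power_zero]
      exact Cardinal.one_le_iff_ne_zero.2 h0
    · have hS' : #S ≤ ℵ₀ := Cardinal.mk_le_aleph0
      calc #(S → F.obj S) = #(F.obj S) ^ #S := (Cardinal.power_def _ _).symm
        _ ≤ #A ^ #S :=
          Cardinal.power_le_power_right ((mk_obj_le_of_mk_le F (hS'.trans h)).trans hA)
        _ ≤ #A ^ ℵ₀ := Cardinal.power_le_power_left h0 hS'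
        _ ≤ #A := hpow
  have h2 : #(Set (ULift.{u} ℕ)) ≤ #A := by
    rw [Cardinal.mk_set, Cardinal.mk_uLift, Cardinal.mk_nat, Cardinal.lift_aleph0]
    exact (Cardinal.power_le_power_right ((Cardinal.natCast_lt_aleph0 (n := 2)).le.trans h)).trans hpow
  have sum_le {J : Type u} (G : J → Type u) (hJ : #J ≤ #A) (hG : ∀ j, #(G j) ≤ #A) :
      #(Σ j, G j) ≤ #A := by
    rw [Cardinal.mk_sigma]
    calc _ ≤ Cardinal.sum fun _ : J ↦ #A := Cardinal.sum_le_sum _ _ hG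
      _ = #J * #A := Cardinal.sum_const' _ _
      _ ≤ #A * #A := by gcongr
      _ = #A := Cardinal.mul_eq_self h
  refine Cardinal.mk_quot_le.trans (sum_le _ (sum_le _ h2 hS) fun i ↦ ?_)
  exact (Cardinal.mk_le_aleph0 (α := i.1)).trans h

/-- Nonemptiness is carried through the induction because `mk_obj_le_of_mk_le` requires it. -/
lemma mk_terminalChain_le (F : Type u ⥤ Type u) {A : Type u} [Nonempty A] [Nonempty (F.obj A)]
    (hA : #(F.obj A) ≤ #A) (n : ℕ) :
    Nonempty (terminalChainObj F n) ∧ #(terminalChainObj F n) ≤ #A := by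
  induction n with
  | zero =>
    let e : terminalChainObj F 0 ≃ PUnit.{u + 1} := Types.terminalIso.toEquiv
    refine ⟨⟨e.symm ⟨⟩⟩, ?_⟩
    rw [Cardinal.mk_congr e, Cardinal.mk_punit]
    exact Cardinal.one_le_iff_ne_zero.2 (Cardinal.mk_ne_zero A)
  | succ n ih =>
    obtain ⟨⟨x⟩, ih⟩ := ih
    have : Nonempty (terminalChainObj F n) := ⟨x⟩
    have f : A ⟶ terminalChainObj F n := ↾fun _ ↦ x
    exact ⟨⟨F.map f (Classical.arbitrary _)⟩, (mk_obj_le_of_mk_le F ih).trans hA⟩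

lemma mk_limit_terminalChain_le (F : Type u ⥤ Type u) {A : Type u} [Nonempty A]
    [Nonempty (F.obj A)] (hA : #(F.obj A) ≤ #A) (hpow : #A ^ ℵ₀ ≤ #A)
    {s : Cone (terminalChain F)} (hs : IsLimit s) : #s.pt ≤ #A := by
  have inj : Function.Injective
      fun (x : s.pt) (n : ULift.{u} ℕ) ↦ Cone.terminalChainProj s n.down x := fun x y e ↦ by
    apply (Types.isLimitEquivSections hs).injective
    ext ⟨n⟩
    exact congrFun e ⟨n⟩
  calc #s.pt ≤ #(∀ n : ULift.{u} ℕ, terminalChainObj F n.down) := Cardinal.mk_le_of_injective inj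
    _ = Cardinal.prod fun n : ULift.{u} ℕ ↦ #(terminalChainObj F n.down) := Cardinal.mk_pi _
    _ ≤ Cardinal.prod fun _ : ULift.{u} ℕ ↦ #A :=
      Cardinal.prod_le_prod _ _ fun n ↦ (mk_terminalChain_le F hA n.down).2
    _ = #A ^ ℵ₀ := by simp
    _ ≤ #A := hpow

/-- The carrier of an initial algebra is at most as large as that of a terminal coalgebra. -/
theorem mk_initialAlgebra_le_mk_terminalCoalgebra {F : Type u ⥤ Type u} {A : Algebra F}
    (hA : IsInitial A) {T : Coalgebra F} (hT : IsTerminal T) : #A.a ≤ #T.V := by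
  obtain h | h := isEmpty_or_nonempty A.a
  · simp
  have := Coalgebra.Terminal.str_isIso hT
  let T' : Algebra F := ⟨T.V, inv T.str⟩
  exact Cardinal.mk_le_of_injective
    (initialAlgebra_hom_injective (T := T') hA (injective_of_mono (inv T.str)) (hA.to T'))

theorem corollaryC (gch : GCH.{u}) (F : Type u ⥤ Type u)
    (hF : PreservesOmegaOpLimits F ∨ IsFinitary F)
    (μF : Algebra F) (hμ : IsInitial μF)
    (huncountable : ℵ₀ < #μF.a) (hregular : Cardinal.IsRegular #μF.a) :
    (∃ νF : Coalgebra F, Nonempty (IsTerminal νF)) ∧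
      ∀ νF : Coalgebra F, IsTerminal νF → #νF.V = #μF.a := by
  have hpow := gch.power_aleph0_le hregular huncountable
  have : IsIso μF.str := Algebra.Initial.str_isIso hμ
  have e : F.obj μF.a ≃ μF.a := (asIso μF.str).toEquiv
  have hA : #(F.obj μF.a) ≤ #μF.a := (Cardinal.mk_congr e).le
  have : Nonempty μF.a := Cardinal.mk_ne_zero_iff.1 hregular.ne_zero
  have : Nonempty (F.obj μF.a) := e.nonempty
  obtain ⟨T, ⟨hT⟩, hle⟩ : ∃ T : Coalgebra F, Nonempty (IsTerminal T) ∧ #T.V ≤ #μF.a := by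
    obtain h | h := hF
    · have : PreservesLimitsOfShape ℕᵒᵖ F := h
      have hs := limit.isLimit (terminalChain F)
      exact ⟨_, ⟨terminalChainCoalgebraIsTerminal hs (isLimitOfPreserves F hs)⟩,
        mk_limit_terminalChain_le F hA hpow hs⟩
    · exact ⟨_, h.countableCoalgebraColimit_isTerminal,
        mk_countableCoalgebraColimit_le F hA hpow huncountable.le⟩
  refine ⟨⟨T, ⟨hT⟩⟩, fun νF hν ↦ le_antisymm ?_ (mk_initialAlgebra_le_mk_terminalCoalgebra hμ hν)⟩
  have i : νF.V ≅ T.V := (Coalgebra.forget F).mapIso (hν.uniqueUpToIso hT)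
  exact (Cardinal.mk_congr i.toEquiv).trans_le hle
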